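/- Let $s\ge 4$ be an integer, let $A_0=\{0,2,3,\dots,s-1,s+1\}=\{0,1,\dots,s+1\}\setminus\{1,s\}$, and let $$E_s=\Big\{\sum_{n=1}^{\infty}\varepsilon_n s^{-n} : \varepsilon_n\in A_0 \text{ for all } n\ge 1\Big\}\subset\mathbb R .$$ Write $\operatorname{fr}E_s$ for the topological boundary of $E_s$ in $\mathbb R$. For $i\ge 0$ put $$\varphi_i(x)=\sum_{k=1}^{i}\frac{2}{s^{k}}+\frac{x}{s^{i+1}},\qquad h(x)=\frac{s+1}{s-1}-x ,$$ so that $\varphi_i$ puts $i$ digits $2$ and then one digit $0$ in front of the digits of $x$, and $h$ replaces every digit $d$ by $s+1-d$. (1) ($\operatorname{fr}E_s$ is $N$-self-similar, up to two points.) For every $i\ge 0$ the maps $\varphi_i$ and $h\circ\varphi_i$ are similarities of $\mathbb R$ with ratio $s^{-(i+1)}$, and $$\operatorname{fr}E_s=\Big\{\frac{2}{s-1},\,1\Big\}\cup\bigcup_{i=0}^{\infty}\Big[\varphi_i(\operatorname{fr}E_s)\cup h(\varphi_i(\operatorname{fr}E_s))\Big].$$ The countably many copies $\varphi_i(\operatorname{fr}E_s)$,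 $h(\varphi_i(\operatorname{fr}E_s))$, $i\ge0$, are pairwise disjoint, and none of them contains $\frac{2}{s-1}$ or $1$. Thus, apart from two points, $\operatorname{fr}E_s$ is a disjoint union of countably many similar copies of itself, two of each ratio $s^{-i}$, $i\ge1$. (2) The Hausdorff–Besicovitch dimension of $\operatorname{fr}E_s$ equals $\log_s 3$, which is the only real solution $x$ of the equation $2\sum_{i=1}^{\infty}s^{-ix}=1$. (3) $E_4$ is the Guthrie–Nymann Cantorval $\big\{\sum_{n=1}^{\infty}\alpha_n4^{-n}:\alpha_n\in\{0,2,3,5\}\big\}$; hence the boundary of the Guthrie–Nymann Cantorval has Hausdorff–Besicovitch dimension $\log_4 3$. -/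

import Mathlib

/-- The digit alphabet `{0, 2, 3, …, s - 1, s + 1}`, that is, `{0, 1, …, s + 1}` without the
digits `1` and `s`. -/
def cantorvalDigits (s : ℕ) : Set ℕ := {d | d ≤ s + 1 ∧ d ≠ 1 ∧ d ≠ s}

/-- The set `E_s` of all sums `∑_{n ≥ 1} ε_n s^{-n}` with digits `ε_n` in the alphabet
`{0, 2, 3, …, s - 1, s + 1}` (the sequence is indexed from `0` here). -/
def cantorvalSet (s : ℕ) : Set ℝ :=
  {x | ∃ ε : ℕ → ℕ, (∀ n, ε n ∈ cantorvalDigits s) ∧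
    HasSum (fun n : ℕ => (ε n : ℝ) / (s : ℝ) ^ (n + 1)) x}

/-- The Guthrie–Nymann Cantorval: all sums `∑_{n ≥ 1} α_n 4^{-n}` with `α_n ∈ {0, 2, 3, 5}`. -/
def guthrieNymannSet : Set ℝ :=
  {x | ∃ α : ℕ → ℕ, (∀ n, α n ∈ ({0, 2, 3, 5} : Set ℕ)) ∧
    HasSum (fun n : ℕ => (α n : ℝ) / (4 : ℝ) ^ (n + 1)) x}

/-- The map which puts the digits `2, …, 2, 0` (`i` digits `2`, then one digit `0`) in front of a
base-`s` digit sequence: `φ_i(x) = ∑_{k = 1}^{i} 2 s^{-k} + s^{-(i + 1)} x`. -/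
noncomputable def prefixMap (s i : ℕ) (x : ℝ) : ℝ :=
  (∑ k ∈ Finset.range i, (2 : ℝ) / (s : ℝ) ^ (k + 1)) + x / (s : ℝ) ^ (i + 1)

/-- The digit inversion `d ↦ s + 1 - d`, that is, the reflection `h(x) = (s + 1)/(s - 1) - x`. -/
noncomputable def digitInversion (s : ℕ) (x : ℝ) : ℝ :=
  ((s : ℝ) + 1) / ((s : ℝ) - 1) - x

/-- The two families of similarities: `φ_i` for `(i, false)` and `h ∘ φ_i` for `(i, true)`. -/
noncomputable def boundarySimilarity (s : ℕ) (p : ℕ × Bool) (x : ℝ) : ℝ :=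
  if p.2 then digitInversion s (prefixMap s p.1 x) else prefixMap s p.1 x

/-! The digits represent every residue class modulo `s` (`s + 1` stands for `1`), so the integer
translates of `E = E_s` cover the line. By Baire, `E` has interior, and by self-similarity it is the
closure of its interior. Since `E ⊆ [0, 5/3]`, a boundary point of `E` must also lie in `E - 1` or
`E + 1`. The two overlaps `B = E ∩ (E - 1)` and `E ∩ (E + 1) = h(B)` therefore contain the boundary.

Comparing the leading digits of `x` and `x + 1` gives `B = B/s ∪ h(B)/s ∪ (2 + B)/s`
(`leftBoundary_eq_iUnion`). The pieces are separated, so `dim B = log_s 3 < 1`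
(`dimH_eq_of_selfSimilar`) and `B` has empty interior. An interior point of `E` in an overlap would
produce an open subset of that overlap; hence `fr E = B ∪ h(B)` exactly, a disjoint union.

The recursion now reads `B = (fr E)/s ∪ (2 + B)/s`. Iterating it yields all `φ_i(fr E)` together
with the fixed point `2/(s - 1)` of the digit-2 branch; reflecting by `h` yields the other half and
the point `1`. -/

open Set Filter Topology
open scoped ENNReal NNReal

/-! ### Hausdorff dimension of self-similar sets with one common ratio -/

/-- A set that is a union of `N` copies of itself, scaled by `b⁻¹`, is covered by `N ^ n` sets of
diameter at most `b⁻ⁿ` times its own diameter. -/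
lemma exists_cover_of_selfSimilar {X : Type*} [MetricSpace X] {N : ℕ} {b : ℝ} (hb : 1 < b)
    {f : Fin N → X → X} (hf : ∀ i x y, dist (f i x) (f i y) = b⁻¹ * dist x y)
    {K : Set X} (hK : IsCompact K) (hKf : K ⊆ ⋃ i, f i '' K) (n : ℕ) :
    ∃ t : (Fin n → Fin N) → Set X,
      (∀ w, Metric.ediam (t w) ≤ ENNReal.ofReal (b⁻¹ ^ n * Metric.diam K)) ∧ K ⊆ ⋃ w, t w := by
  have hb0 : 0 < b := by linarith
  induction n with
  | zero =>
    refine ⟨fun _ => K, fun _ => ?_, fun x hx => mem_iUnion.2 ⟨Fin.elim0, hx⟩⟩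
    simp [Metric.diam, ENNReal.ofReal_toReal hK.isBounded.ediam_ne_top]
  | succ n ih =>
    obtain ⟨t, ht, hKt⟩ := ih
    refine ⟨fun w => f (w 0) '' t (Fin.tail w), fun w => ?_, fun x hx => ?_⟩
    · have hL : LipschitzWith (Real.toNNReal b⁻¹) (f (w 0)) :=
        LipschitzWith.of_dist_le_mul fun x y => by
          rw [hf, Real.coe_toNNReal _ (by positivity)]
      refine (hL.ediam_image_le _).trans ?_
      calc _ ≤ ENNReal.ofReal b⁻¹ * ENNReal.ofReal (b⁻¹ ^ n * Metric.diam K) := by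
            gcongr
            · exact le_rfl
            · exact ht _
        _ = _ := by rw [← ENNReal.ofReal_mul (by positivity)]; congr 1; ring
    · obtain ⟨i, y, hy, rfl⟩ := mem_iUnion.1 (hKf hx)
      obtain ⟨w, hw⟩ := mem_iUnion.1 (hKt hy)
      exact mem_iUnion.2 ⟨Fin.cons i w, y, by simpa using hw, by simp⟩

/-- With exponent `log_b N`, the `N ^ n` pieces of size `b⁻ⁿ` have total weight exactly `1`. -/
lemma inv_pow_rpow_logb {b a : ℝ} (hb : 1 < b) (ha : 0 < a) (n : ℕ) :
    (b⁻¹ ^ n) ^ Real.logb b a = (a ^ n)⁻¹ := by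
  have hb0 : 0 < b := by linarith
  rw [inv_pow, Real.inv_rpow (by positivity), ← Real.rpow_natCast_mul hb0.le, mul_comm,
    Real.rpow_mul_natCast hb0.le, Real.rpow_logb hb0 hb.ne' ha]

/-- The upper bound for the dimension of a self-similar set. -/
lemma dimH_le_of_selfSimilar {X : Type*} [MetricSpace X] {N : ℕ} (hN : 1 ≤ N) {b : ℝ} (hb : 1 < b)
    {f : Fin N → X → X} (hf : ∀ i x y, dist (f i x) (f i y) = b⁻¹ * dist x y)
    {K : Set X} (hK : IsCompact K) (hKf : K ⊆ ⋃ i, f i '' K) :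
    dimH K ≤ ENNReal.ofReal (Real.logb b N) := by
  borelize X
  have hb0 : 0 < b := by linarith
  have hN0 : (0 : ℝ) < N := by positivity
  have hr : 0 ≤ Real.logb b N := Real.logb_nonneg hb (by exact_mod_cast hN)
  choose t ht hKt using exists_cover_of_selfSimilar hb hf hK hKf
  have key := MeasureTheory.Measure.hausdorffMeasure_le_liminf_sum (l := atTop) (Real.logb b N) K
    (fun n : ℕ => ENNReal.ofReal (b⁻¹ ^ n * Metric.diam K)) (by
      rw [← ENNReal.ofReal_zero]
      apply ENNReal.tendsto_ofReal
      simpa using (tendsto_pow_atTop_nhds_zero_of_lt_one (by positivity)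
        (inv_lt_one_of_one_lt₀ hb)).mul_const (Metric.diam K))
    t (Eventually.of_forall ht) (Eventually.of_forall hKt)
  have hbd : ∀ n, ∑ w, Metric.ediam (t n w) ^ Real.logb b N
      ≤ ENNReal.ofReal (Metric.diam K ^ Real.logb b N) := fun n => by
    calc _ ≤ ∑ _w : Fin n → Fin N,
          ENNReal.ofReal ((N ^ n : ℝ)⁻¹ * Metric.diam K ^ Real.logb b N) := by
          refine Finset.sum_le_sum fun w _ => ?_
          refine (ENNReal.rpow_le_rpow (ht n w) hr).trans_eq ?_
          rw [ENNReal.ofReal_rpow_of_nonneg (by positivity) hr,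
            Real.mul_rpow (by positivity) (by positivity), inv_pow_rpow_logb hb hN0]
      _ = _ := by
          rw [Finset.sum_const, ← ENNReal.ofReal_nsmul]
          congr 1
          simp
          field_simp
  have hfin : MeasureTheory.Measure.hausdorffMeasure (Real.logb b N) K ≠ ∞ := by
    refine ne_top_of_le_ne_top (b := ENNReal.ofReal (Metric.diam K ^ Real.logb b N))
      ENNReal.ofReal_ne_top (key.trans ?_)
    exact (liminf_le_liminf (Eventually.of_forall hbd)).trans_eq (liminf_const _)
  exact dimH_le_of_hausdorffMeasure_ne_top (d := (Real.logb b N).toNNReal)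
    (by rwa [Real.coe_toNNReal _ hr])

/-- The composition `f (t 0) ∘ f (t 1) ∘ ⋯ ∘ f (t (n - 1))`. -/
def prefixComp {X : Type*} {N : ℕ} (f : Fin N → X → X) (t : ℕ → Fin N) : ℕ → X → X
  | 0 => id
  | n + 1 => prefixComp f t n ∘ f (t n)

lemma prefixComp_congr {X : Type*} {N : ℕ} (f : Fin N → X → X) {t u : ℕ → Fin N} {n : ℕ}
    (h : ∀ i < n, t i = u i) : prefixComp f t n = prefixComp f u n := by
  induction n with
  | zero => rfl
  | succ n ih =>
    rw [prefixComp, prefixComp, ih fun i hi => h i (by omega), h n (by omega)]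

lemma dist_prefixComp {X : Type*} [MetricSpace X] {N : ℕ} {b : ℝ}
    {f : Fin N → X → X} (hf : ∀ i x y, dist (f i x) (f i y) = b⁻¹ * dist x y) (t : ℕ → Fin N)
    (n : ℕ) (x y : X) :
    dist (prefixComp f t n x) (prefixComp f t n y) = b⁻¹ ^ n * dist x y := by
  induction n generalizing x y with
  | zero => simp [prefixComp]
  | succ n ih => rw [prefixComp, Function.comp, Function.comp, ih, hf]; ring

/-- Every digit sequence is the address of a point of the self-similar set. -/
lemma exists_forall_mem_prefixComp_image {X : Type*} [MetricSpace X] {N : ℕ} {b : ℝ} (hb : 1 < b)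
    {f : Fin N → X → X} (hf : ∀ i x y, dist (f i x) (f i y) = b⁻¹ * dist x y)
    {K : Set X} (hK : IsCompact K) (hne : K.Nonempty) (hfK : ∀ i, MapsTo (f i) K K)
    (t : ℕ → Fin N) : ∃ x, ∀ n, x ∈ prefixComp f t n '' K := by
  have hb0 : 0 < b := by linarith
  have hcomp : ∀ n, IsCompact (prefixComp f t n '' K) := fun n => by
    refine hK.image (LipschitzWith.continuous (K := Real.toNNReal (b⁻¹ ^ n)) ?_)
    refine LipschitzWith.of_dist_le_mul fun x y => ?_
    rw [dist_prefixComp hf, Real.coe_toNNReal _ (by positivity)]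
  obtain ⟨x, hx⟩ := IsCompact.nonempty_iInter_of_sequence_nonempty_isCompact_isClosed
    (fun n => prefixComp f t n '' K)
    (fun n => by
      rw [prefixComp, image_comp]
      exact image_mono (hfK _).image_subset)
    (fun n => hne.image _) (hcomp 0) (fun n => (hcomp n).isClosed)
  exact ⟨x, mem_iInter.1 hx⟩

/-- The lower bound for the dimension of a self-similar set with separated pieces. -/
lemma le_dimH_of_selfSimilar {X : Type*} [MetricSpace X] {N : ℕ} (hN : 2 ≤ N) {b : ℝ} (hb : 1 < b)
    {f : Fin N → X → X} (hf : ∀ i x y, dist (f i x) (f i y) = b⁻¹ * dist x y)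
    {K : Set X} (hK : IsCompact K) (hne : K.Nonempty) (hfK : ∀ i, MapsTo (f i) K K)
    {δ : ℝ} (hδ : 0 < δ)
    (hsep : ∀ i j, i ≠ j → ∀ x ∈ K, ∀ y ∈ K, δ ≤ dist (f i x) (f j y)) :
    ENNReal.ofReal (Real.logb b N) ≤ dimH K := by
  have hb0 : 0 < b := by linarith
  have hN0 : (0 : ℝ) < N := by positivity
  have hr : 0 < Real.logb b N := Real.logb_pos hb (by exact_mod_cast hN)
  choose p hp using exists_forall_mem_prefixComp_image hb hf hK hne hfK
  -- After the common prefix is stripped off, the two points lie in different first-level pieces,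
  -- which are `δ` apart.
  have hdist : ∀ t u n, (∀ i < n, t i = u i) → t n ≠ u n → b⁻¹ ^ n * δ ≤ dist (p t) (p u) := by
    intro t u n h hn
    obtain ⟨x, hx, hxt⟩ := hp t (n + 1)
    obtain ⟨y, hy, hyu⟩ := hp u (n + 1)
    rw [← hxt, ← hyu, prefixComp, prefixComp, prefixComp_congr f h, Function.comp, Function.comp,
      dist_prefixComp hf]
    gcongr
    exact hsep _ _ hn x hx y hy
  have hfirst : ∀ t u : ℕ → Fin N, t ≠ u → ∃ n, (∀ i < n, t i = u i) ∧ t n ≠ u n := by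
    intro t u h
    classical
    have hex := Function.ne_iff.1 h
    exact ⟨Nat.find hex, fun i hi => not_not.1 (Nat.find_min hex hi), Nat.find_spec hex⟩
  have hinj : Function.Injective p := by
    intro t u h
    by_contra hne'
    obtain ⟨n, h1, h2⟩ := hfirst t u hne'
    have h3 := hdist t u n h1 h2
    rw [h, dist_self] at h3
    have : 0 < b⁻¹ ^ n * δ := by positivity
    linarith
  have : Nonempty (ℕ → Fin N) := ⟨fun _ => ⟨0, by omega⟩⟩
  have hinv := Function.leftInverse_invFun hinj
  -- Reading the address of a point as a base-`N` expansion is Hölder of exponent `log_b N`: a first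
  -- disagreement at place `n` moves the value by at most `N⁻ⁿ = (b⁻ⁿ) ^ log_b N`. The image is `[0,
  -- 1]`, of dimension `1`.
  have hH : HolderOnWith (Real.toNNReal ((δ ^ Real.logb b N)⁻¹)) (Real.toNNReal (Real.logb b N))
      (fun x => Real.ofDigits (Function.invFun p x)) (range p) := by
    rintro _ ⟨t, rfl⟩ _ ⟨u, rfl⟩
    simp only [hinv t, hinv u]
    by_cases htu : t = u
    · simp [htu]
    obtain ⟨n, h1, h2⟩ := hfirst t u htu
    have h3 := hdist t u n h1 h2
    rw [edist_dist, edist_dist, Real.coe_toNNReal _ hr.le,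
      ENNReal.ofReal_rpow_of_nonneg dist_nonneg hr.le]
    change _ ≤ ENNReal.ofReal _ * _
    rw [← ENNReal.ofReal_mul (by positivity)]
    refine ENNReal.ofReal_le_ofReal ?_
    rw [Real.dist_eq]
    refine (Real.abs_ofDigits_sub_ofDigits_le h1).trans ?_
    have h4 := Real.rpow_le_rpow (by positivity) h3 hr.le
    rw [Real.mul_rpow (by positivity) hδ.le, inv_pow_rpow_logb hb hN0] at h4
    have h5 : 0 < δ ^ Real.logb b N := Real.rpow_pos_of_pos hδ _
    rw [inv_mul_eq_div, le_div_iff₀ h5]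
    exact h4
  have himg : Icc (0 : ℝ) 1 ⊆ (fun x => Real.ofDigits (Function.invFun p x)) '' range p := by
    intro y hy
    obtain ⟨t, -, rfl⟩ := Real.ofDigits_SurjOn (b := N) (by omega) hy
    exact ⟨p t, ⟨t, rfl⟩, by simp only [hinv t]⟩
  have h1 : (1 : ℝ≥0∞) ≤ dimH (Icc (0 : ℝ) 1) := by
    rw [Real.dimH_of_nonempty_interior (by simp)]; simp
  have h2 := hH.dimH_image_le (Real.toNNReal_pos.2 hr)
  have h3 : (1 : ℝ≥0∞) ≤ dimH (range p) / ENNReal.ofReal (Real.logb b N) :=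
    h1.trans ((dimH_mono himg).trans h2)
  have hpK : range p ⊆ K := by
    rintro _ ⟨t, rfl⟩
    simpa [prefixComp] using hp t 0
  rw [ENNReal.le_div_iff_mul_le (by simp [hr]) (by simp), one_mul] at h3
  exact h3.trans (dimH_mono hpK)

/-- A compact set that is the union of `N` separated copies of itself, scaled by `b⁻¹`, has
Hausdorff dimension `log_b N`. -/
theorem dimH_eq_of_selfSimilar {X : Type*} [MetricSpace X] {N : ℕ} (hN : 2 ≤ N) {b : ℝ}
    (hb : 1 < b) {f : Fin N → X → X} (hf : ∀ i x y, dist (f i x) (f i y) = b⁻¹ * dist x y)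
    {K : Set X} (hK : IsCompact K) (hne : K.Nonempty) (hKf : K = ⋃ i, f i '' K)
    {δ : ℝ} (hδ : 0 < δ)
    (hsep : ∀ i j, i ≠ j → ∀ x ∈ K, ∀ y ∈ K, δ ≤ dist (f i x) (f j y)) :
    dimH K = ENNReal.ofReal (Real.logb b N) := by
  refine le_antisymm (dimH_le_of_selfSimilar (by omega) hb hf hK hKf.subset)
    (le_dimH_of_selfSimilar hN hb hf hK hne (fun i x hx => ?_) hδ hsep)
  rw [hKf]
  exact mem_iUnion.2 ⟨i, x, hx, rfl⟩

/-! ### Digit recursion, compactness and symmetry of `E_s` -/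

lemma hasSum_const_div_pow {s : ℕ} (hs : 2 ≤ s) (c : ℝ) :
    HasSum (fun n : ℕ => c / (s : ℝ) ^ (n + 1)) (c / ((s : ℝ) - 1)) := by
  have hs' : (2 : ℝ) ≤ s := by exact_mod_cast hs
  have h := (hasSum_geometric_of_lt_one (r := (s : ℝ)⁻¹) (by positivity)
    (inv_lt_one_of_one_lt₀ (by linarith))).mul_left (c / s)
  convert! h using 1
  · ext n
    rw [inv_pow, pow_succ]; field_simp
  · have : (s : ℝ) - 1 ≠ 0 := by linarith
    have : (s : ℝ) ≠ 0 := by linarith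
    field_simp

lemma mem_cantorvalSet_iff {s : ℕ} (hs : 4 ≤ s) {x : ℝ} :
    x ∈ cantorvalSet s ↔
      ∃ d ∈ cantorvalDigits s, ∃ y ∈ cantorvalSet s, x = ((d : ℝ) + y) / s := by
  have hs0 : (s : ℝ) ≠ 0 := by positivity
  constructor
  · rintro ⟨ε, hε, hx⟩
    refine ⟨ε 0, hε 0, s * x - ε 0, ⟨fun n => ε (n + 1), fun n => hε _, ?_⟩, by field_simp; ring⟩
    have h := ((hasSum_nat_add_iff' 1).2 hx).mul_left (s : ℝ)
    convert! h using 1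
    · ext n; rw [pow_succ (s : ℝ) (n + 1)]; field_simp
    · simp; field_simp
  · rintro ⟨d, hd, y, ⟨ε, hε, hy⟩, rfl⟩
    refine ⟨fun n => Nat.casesOn n d ε, fun n => ?_, ?_⟩
    · cases n with
      | zero => exact hd
      | succ n => exact hε n
    · rw [← hasSum_nat_add_iff' 1]
      have h := hy.div_const (s : ℝ)
      convert! h using 1
      · ext n; rw [pow_succ (s : ℝ) (n + 1)]; field_simp
      · simp; field_simp; ring

lemma cantorvalSet_subset_Icc {s : ℕ} (hs : 4 ≤ s) :
    cantorvalSet s ⊆ Icc 0 (((s : ℝ) + 1) / ((s : ℝ) - 1)) := by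
  rintro x ⟨ε, hε, hx⟩
  refine ⟨hx.nonneg fun n => by positivity, hasSum_le (fun n => ?_) hx
    (hasSum_const_div_pow (by omega) _)⟩
  gcongr
  exact_mod_cast (hε n).1

lemma const_mem_cantorvalSet {s : ℕ} (hs : 4 ≤ s) {d : ℕ} (hd : d ∈ cantorvalDigits s) :
    (d : ℝ) / ((s : ℝ) - 1) ∈ cantorvalSet s :=
  ⟨fun _ => d, fun _ => hd, hasSum_const_div_pow (by omega) _⟩

lemma two_mem_cantorvalDigits {s : ℕ} (hs : 4 ≤ s) : 2 ∈ cantorvalDigits s :=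
  ⟨by omega, by omega, by omega⟩

lemma zero_mem_cantorvalDigits {s : ℕ} (hs : 4 ≤ s) : 0 ∈ cantorvalDigits s :=
  ⟨by omega, by omega, by omega⟩

lemma pred_mem_cantorvalDigits {s : ℕ} (hs : 4 ≤ s) : s - 1 ∈ cantorvalDigits s :=
  ⟨by omega, by omega, by omega⟩

lemma succ_mem_cantorvalDigits {s : ℕ} (hs : 4 ≤ s) : s + 1 ∈ cantorvalDigits s :=
  ⟨by omega, by omega, by omega⟩

lemma isCompact_cantorvalSet {s : ℕ} (hs : 4 ≤ s) : IsCompact (cantorvalSet s) := by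
  have hs1 : (4 : ℝ) ≤ s := by exact_mod_cast hs
  -- Truncating digits at `s + 1` gives a uniform summable bound on all of `ℕ → ℕ` and changes
  -- nothing on admissible sequences.
  have hcont : Continuous fun ε : ℕ → ℕ =>
      ∑' n, ((min (ε n) (s + 1) : ℕ) : ℝ) / (s : ℝ) ^ (n + 1) := by
    refine continuous_tsum (u := fun n => ((s : ℝ) + 1) / (s : ℝ) ^ (n + 1)) (fun n => ?_)
      (hasSum_const_div_pow (by omega) _).summable fun n ε => ?_
    · have : Continuous fun k : ℕ => ((min k (s + 1) : ℕ) : ℝ) / (s : ℝ) ^ (n + 1) :=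
        continuous_of_discreteTopology
      exact this.comp (continuous_apply n)
    · rw [Real.norm_of_nonneg (by positivity)]
      gcongr
      exact_mod_cast min_le_right _ _
  have hfin : (cantorvalDigits s).Finite := (finite_Iic (s + 1)).subset fun d hd => hd.1
  have hc := (isCompact_univ_pi fun _ : ℕ => hfin.isCompact).image hcont
  convert! hc using 1
  ext x
  have hmin : ∀ ε : ℕ → ℕ, (∀ n, ε n ∈ cantorvalDigits s) →
      (fun n => ((min (ε n) (s + 1) : ℕ) : ℝ) / (s : ℝ) ^ (n + 1)) =
        fun n => (ε n : ℝ) / (s : ℝ) ^ (n + 1) := fun ε hε => by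
    ext n; rw [min_eq_left (hε n).1]
  constructor
  · rintro ⟨ε, hε, hx⟩
    exact ⟨ε, fun n _ => hε n, by simp only [hmin ε hε, hx.tsum_eq]⟩
  · rintro ⟨ε, hε, rfl⟩
    have hε' : ∀ n, ε n ∈ cantorvalDigits s := fun n => hε n (mem_univ n)
    refine ⟨ε, hε', ?_⟩
    simp only [hmin ε hε']
    refine Summable.hasSum (Summable.of_nonneg_of_le (fun n => by positivity) (fun n => ?_)
      (hasSum_const_div_pow (s := s) (by omega) ((s : ℝ) + 1)).summable)
    gcongr
    exact_mod_cast (hε' n).1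

lemma digitInversion_mem_cantorvalSet {s : ℕ} (hs : 4 ≤ s) {x : ℝ} (hx : x ∈ cantorvalSet s) :
    digitInversion s x ∈ cantorvalSet s := by
  obtain ⟨ε, hε, hx⟩ := hx
  refine ⟨fun n => s + 1 - ε n, fun n => ?_, ?_⟩
  · obtain ⟨h1, h2, h3⟩ := hε n
    change s + 1 - ε n ≤ s + 1 ∧ s + 1 - ε n ≠ 1 ∧ s + 1 - ε n ≠ s
    omega
  · convert! (hasSum_const_div_pow (s := s) (by omega) ((s : ℝ) + 1)).sub hx using 1
    ext n
    rw [Nat.cast_sub (hε n).1]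
    push_cast
    ring

lemma digitInversion_digitInversion (s : ℕ) (x : ℝ) :
    digitInversion s (digitInversion s x) = x := by
  simp [digitInversion]

lemma digitInversion_mem_cantorvalSet_iff {s : ℕ} (hs : 4 ≤ s) {x : ℝ} :
    digitInversion s x ∈ cantorvalSet s ↔ x ∈ cantorvalSet s :=
  ⟨fun h => digitInversion_digitInversion s x ▸ digitInversion_mem_cantorvalSet hs h,
    digitInversion_mem_cantorvalSet hs⟩

lemma cantorvalSet_bound {s : ℕ} (hs : 4 ≤ s) : ((s : ℝ) + 1) / ((s : ℝ) - 1) ≤ 5 / 3 := by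
  have hs1 : (4 : ℝ) ≤ s := by exact_mod_cast hs
  rw [div_le_div_iff₀ (by linarith) (by norm_num)]
  linarith

/-! ### Covering by integer translates, and the interior of `E_s` -/

/-- The digits form a complete residue system modulo `s`. -/
lemma exists_cantorvalDigit_modEq {s : ℕ} (hs : 4 ≤ s) (m : ℤ) :
    ∃ d ∈ cantorvalDigits s, ∃ k : ℤ, m = d + s * k := by
  have h0 := Int.emod_nonneg m (show (s : ℤ) ≠ 0 by omega)
  have h1 := Int.emod_lt_of_pos m (show (0 : ℤ) < s by omega)
  have h2 := Int.emod_add_mul_ediv m s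
  -- The missing residue `1` is represented by the digit `s + 1`, with the quotient lowered by one.
  by_cases h : m % s = 1
  · exact ⟨s + 1, succ_mem_cantorvalDigits hs, m / s - 1, by push_cast; rw [mul_sub]; linarith⟩
  · exact ⟨(m % s).toNat, ⟨by omega, by omega, by omega⟩, m / s, by
      rw [Int.toNat_of_nonneg h0]; exact h2.symm⟩

open scoped Pointwise in
/-- The integer translates of `E_s` cover the line. -/
lemma exists_int_sub_mem_cantorvalSet {s : ℕ} (hs : 4 ≤ s) (x : ℝ) :
    ∃ k : ℤ, x - k ∈ cantorvalSet s := by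
  have hs1 : (4 : ℝ) ≤ s := by exact_mod_cast hs
  have hs0 : (0 : ℝ) < s := by linarith
  -- The covering is first shown for the dense set of points `m / s ^ n`: the integer part `k` is
  -- split as `d + s * j`, and `d` becomes a new leading digit. Closedness of `E_s + ℤ` then gives
  -- every real.
  have hgrid : ∀ (n : ℕ) (m : ℤ), ∃ k : ℤ, (m : ℝ) / (s : ℝ) ^ n - k ∈ cantorvalSet s := by
    intro n
    induction n with
    | zero =>
      exact fun m => ⟨m, by simpa using const_mem_cantorvalSet hs (zero_mem_cantorvalDigits hs)⟩
    | succ n ih =>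
      intro m
      obtain ⟨k, hk⟩ := ih m
      obtain ⟨d, hd, j, hj⟩ := exists_cantorvalDigit_modEq hs k
      refine ⟨j, (mem_cantorvalSet_iff hs).2 ⟨d, hd, _, hk, ?_⟩⟩
      have : (k : ℝ) = d + s * j := by exact_mod_cast hj
      rw [this, pow_succ]
      field_simp
      ring
  have hclosed : IsClosed (cantorvalSet s + range ((↑) : ℤ → ℝ)) :=
    Int.isClosedEmbedding_coe_real.isClosed_range.add_left_of_isCompact (isCompact_cantorvalSet hs)
  have hlim : Tendsto (fun n : ℕ => ((⌊x * (s : ℝ) ^ n⌋ : ℤ) : ℝ) / (s : ℝ) ^ n) atTop (𝓝 x) := by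
    have h0 : Tendsto (fun n : ℕ => x - (s : ℝ)⁻¹ ^ n) atTop (𝓝 x) := by
      simpa using tendsto_const_nhds.sub (tendsto_pow_atTop_nhds_zero_of_lt_one (by positivity)
        (inv_lt_one_of_one_lt₀ (by linarith : (1 : ℝ) < s)))
    refine tendsto_of_tendsto_of_tendsto_of_le_of_le h0 tendsto_const_nhds (fun n => ?_) fun n => ?_
    · have := Int.lt_floor_add_one (x * (s : ℝ) ^ n)
      simp only [inv_pow]
      rw [le_div_iff₀ (by positivity), sub_mul, inv_mul_cancel₀ (by positivity)]
      linarith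
    · have := Int.floor_le (x * (s : ℝ) ^ n)
      exact (div_le_iff₀ (by positivity)).2 this
  have hx := hclosed.mem_of_tendsto hlim (Eventually.of_forall fun n => by
    obtain ⟨k, hk⟩ := hgrid n ⌊x * (s : ℝ) ^ n⌋
    exact ⟨_, hk, _, ⟨k, rfl⟩, by simp⟩)
  obtain ⟨y, hy, _, ⟨k, rfl⟩, h⟩ := hx
  exact ⟨k, by rw [← h]; simpa using hy⟩

/-- Baire category: countably many closed translates cover the line, so one of them has interior. -/
lemma interior_cantorvalSet_nonempty {s : ℕ} (hs : 4 ≤ s) :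
    (interior (cantorvalSet s)).Nonempty := by
  have hcl := (isCompact_cantorvalSet hs).isClosed
  obtain ⟨k, x, hx⟩ := nonempty_interior_of_iUnion_of_closed
    (f := fun k : ℤ => (Homeomorph.subRight (k : ℝ)) ⁻¹' cantorvalSet s)
    (fun k => hcl.preimage (Homeomorph.continuous _))
    (eq_univ_of_forall fun x => mem_iUnion.2 (exists_int_sub_mem_cantorvalSet hs x))
  rw [← Homeomorph.preimage_interior] at hx
  exact ⟨_, hx⟩

/-- `E_s` is the closure of its interior. -/
lemma cantorvalSet_subset_closure_interior {s : ℕ} (hs : 4 ≤ s) :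
    cantorvalSet s ⊆ closure (interior (cantorvalSet s)) := by
  have hs1 : (4 : ℝ) ≤ s := by exact_mod_cast hs
  have hs0 : (0 : ℝ) < s := by linarith
  obtain ⟨z, hz⟩ := interior_cantorvalSet_nonempty hs
  have hmap : ∀ d ∈ cantorvalDigits s, ∀ y ∈ interior (cantorvalSet s),
      ((d : ℝ) + y) / s ∈ interior (cantorvalSet s) := by
    intro d hd y hy
    let e : ℝ ≃ₜ ℝ := (Homeomorph.addLeft (d : ℝ)).trans
      (Homeomorph.mulRight₀ ((s : ℝ)⁻¹) (by positivity))
    have he : e '' cantorvalSet s ⊆ cantorvalSet s := by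
      rintro _ ⟨w, hw, rfl⟩
      exact (mem_cantorvalSet_iff hs).2 ⟨d, hd, w, hw, by simp [e, div_eq_mul_inv]⟩
    have := interior_mono he (e.image_interior _ ▸ mem_image_of_mem e hy)
    simpa [e, div_eq_mul_inv] using this
  -- Keeping the first `n` digits of `x` and replacing its tail by the interior point `z` gives an
  -- interior point.
  have happrox : ∀ (n : ℕ), ∀ x ∈ cantorvalSet s, ∃ y ∈ interior (cantorvalSet s),
      |x - y| ≤ (5 / 3 + |z|) * (s : ℝ)⁻¹ ^ n := by
    intro n
    induction n with
    | zero =>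
      intro x hx
      refine ⟨z, hz, ?_⟩
      have h1 := cantorvalSet_subset_Icc hs hx
      have h2 := cantorvalSet_bound hs
      have h3 := abs_sub x z
      rw [abs_of_nonneg h1.1] at h3
      rw [pow_zero, mul_one]
      linarith [h1.2]
    | succ n ih =>
      intro x hx
      obtain ⟨d, hd, x', hx', rfl⟩ := (mem_cantorvalSet_iff hs).1 hx
      obtain ⟨y, hy, hxy⟩ := ih x' hx'
      refine ⟨_, hmap d hd y hy, ?_⟩
      rw [← sub_div, add_sub_add_left_eq_sub, abs_div, abs_of_pos hs0, pow_succ, ← mul_assoc,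
        div_eq_mul_inv]
      gcongr
  intro x hx
  rw [Metric.mem_closure_iff]
  intro ε hε
  have hlim : Tendsto (fun n : ℕ => (5 / 3 + |z|) * (s : ℝ)⁻¹ ^ n) atTop (𝓝 0) := by
    simpa using (tendsto_pow_atTop_nhds_zero_of_lt_one (by positivity)
      (inv_lt_one_of_one_lt₀ (by linarith : (1 : ℝ) < s))).const_mul (5 / 3 + |z|)
  obtain ⟨n, hn⟩ := (hlim.eventually_lt_const hε).exists
  obtain ⟨y, hy, hxy⟩ := happrox n x hx
  exact ⟨y, hy, by rw [Real.dist_eq]; linarith⟩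

/-! ### The overlap of `E_s` with `E_s - 1` -/

/-- The intersection of `E_s` with its translate `E_s - 1`. -/
def leftBoundary (s : ℕ) : Set ℝ := {x | x ∈ cantorvalSet s ∧ x + 1 ∈ cantorvalSet s}

lemma digitInversion_mem_leftBoundary_iff {s : ℕ} (hs : 4 ≤ s) {x : ℝ} :
    digitInversion s x ∈ leftBoundary s ↔ x ∈ cantorvalSet s ∧ x - 1 ∈ cantorvalSet s := by
  have h : digitInversion s x + 1 = digitInversion s (x - 1) := by simp only [digitInversion]; ring
  rw [leftBoundary, mem_ofPred_eq, h, digitInversion_mem_cantorvalSet_iff hs,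
    digitInversion_mem_cantorvalSet_iff hs]

/-- If `x = (a + x')/s` and `x + 1 = (b + y')/s`, the tails differ by the integer `s + a - b`. As
both tails lie in `[0, 5/3]`, this carry is `-1`, `0` or `1`, and few digit pairs allow it. -/
lemma mem_leftBoundary_iff {s : ℕ} (hs : 4 ≤ s) {x : ℝ} :
    x ∈ leftBoundary s ↔ s * x ∈ leftBoundary s ∨ s * x - 2 ∈ leftBoundary s ∨
      digitInversion s (s * x) ∈ leftBoundary s := by
  have hs1 : (4 : ℝ) ≤ s := by exact_mod_cast hs
  have hs0 : (0 : ℝ) < s := by linarith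
  rw [digitInversion_mem_leftBoundary_iff hs]
  constructor
  · rintro ⟨h1, h2⟩
    obtain ⟨a, ha, x', hx', hx⟩ := (mem_cantorvalSet_iff hs).1 h1
    obtain ⟨b, hb, y', hy', hy⟩ := (mem_cantorvalSet_iff hs).1 h2
    rw [eq_div_iff hs0.ne'] at hx hy
    have hxI := cantorvalSet_subset_Icc hs hx'
    have hyI := cantorvalSet_subset_Icc hs hy'
    have hbd := cantorvalSet_bound hs
    have hk : y' - x' = (((s : ℤ) + a - b : ℤ) : ℝ) := by push_cast; linarith
    have hk1 : (s : ℤ) + a - b < 2 := by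
      have : (((s : ℤ) + a - b : ℤ) : ℝ) < (2 : ℤ) := by
        rw [← hk]; push_cast; linarith [hxI.1, hyI.2]
      exact_mod_cast this
    have hk2 : -2 < (s : ℤ) + a - b := by
      have : ((-2 : ℤ) : ℝ) < (((s : ℤ) + a - b : ℤ) : ℝ) := by
        rw [← hk]; push_cast; linarith [hyI.1, hxI.2]
      exact_mod_cast this
    obtain ⟨ha1, ha2, ha3⟩ := ha
    obtain ⟨hb1, hb2, hb3⟩ := hb
    -- Carry `0` would need `b = s + a`, so `(a, b)` would be `(0, s)` or `(1, s + 1)`, both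
    -- excluded by the missing digits. Carry `1` leaves `(0, s - 1)` and `(2, s + 1)`; carry `-1`
    -- leaves `(0, s + 1)`.
    have hcases : (a = 0 ∧ (s : ℤ) + a - b = 1) ∨ (a = 2 ∧ (s : ℤ) + a - b = 1) ∨
        (a = 0 ∧ (s : ℤ) + a - b = -1) := by omega
    rcases hcases with ⟨rfl, hk'⟩ | ⟨rfl, hk'⟩ | ⟨rfl, hk'⟩ <;> rw [hk'] at hk <;> push_cast at hk hx
    · left
      rw [show (s : ℝ) * x = x' by linarith]
      exact ⟨hx', by rwa [show x' + 1 = y' by linarith]⟩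
    · right; left
      rw [show (s : ℝ) * x - 2 = x' by linarith]
      exact ⟨hx', by rwa [show x' + 1 = y' by linarith]⟩
    · right; right
      rw [show (s : ℝ) * x = x' by linarith]
      exact ⟨hx', by rwa [show x' - 1 = y' by linarith]⟩
  · have hc : (((s - 1 : ℕ) : ℕ) : ℝ) = s - 1 := by push_cast [show 1 ≤ s by omega]; ring
    rintro (⟨h1, h2⟩ | ⟨h1, h2⟩ | ⟨h1, h2⟩)
    · refine ⟨(mem_cantorvalSet_iff hs).2 ⟨_, zero_mem_cantorvalDigits hs, _, h1, ?_⟩,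
        (mem_cantorvalSet_iff hs).2 ⟨_, pred_mem_cantorvalDigits hs, _, h2, ?_⟩⟩
      · push_cast; field_simp; ring
      · rw [hc]; field_simp; ring
    · refine ⟨(mem_cantorvalSet_iff hs).2 ⟨_, two_mem_cantorvalDigits hs, _, h1, ?_⟩,
        (mem_cantorvalSet_iff hs).2 ⟨_, succ_mem_cantorvalDigits hs, _, h2, ?_⟩⟩
      · push_cast; field_simp; ring
      · push_cast; field_simp; ring
    · refine ⟨(mem_cantorvalSet_iff hs).2 ⟨_, zero_mem_cantorvalDigits hs, _, h1, ?_⟩,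
        (mem_cantorvalSet_iff hs).2 ⟨_, succ_mem_cantorvalDigits hs, _, h2, ?_⟩⟩
      · push_cast; field_simp; ring
      · push_cast; field_simp; ring

lemma isCompact_leftBoundary {s : ℕ} (hs : 4 ≤ s) : IsCompact (leftBoundary s) :=
  (isCompact_cantorvalSet hs).inter_right
    ((isCompact_cantorvalSet hs).isClosed.preimage (continuous_add_const 1))

lemma leftBoundary_subset_Icc {s : ℕ} (hs : 4 ≤ s) :
    leftBoundary s ⊆ Icc 0 (2 / ((s : ℝ) - 1)) := by
  have hs1 : (4 : ℝ) ≤ s := by exact_mod_cast hs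
  rintro x ⟨h1, h2⟩
  have h3 := (cantorvalSet_subset_Icc hs h2).2
  have h4 : ((s : ℝ) + 1) / ((s : ℝ) - 1) = 2 / ((s : ℝ) - 1) + 1 := by
    have : (s : ℝ) - 1 ≠ 0 := by linarith
    field_simp; ring
  exact ⟨(cantorvalSet_subset_Icc hs h1).1, by linarith⟩

lemma two_div_le {s : ℕ} (hs : 4 ≤ s) : 2 / ((s : ℝ) - 1) ≤ 2 / 3 := by
  have hs1 : (4 : ℝ) ≤ s := by exact_mod_cast hs
  gcongr
  linarith

lemma digitInversion_two_div {s : ℕ} (hs : 4 ≤ s) : digitInversion s (2 / ((s : ℝ) - 1)) = 1 := by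
  have hs1 : (4 : ℝ) ≤ s := by exact_mod_cast hs
  have : (s : ℝ) - 1 ≠ 0 := by linarith
  rw [digitInversion]; field_simp; ring

/-- The constant expansions `2, 2, …` and `s + 1, s + 1, …` have values exactly `1` apart. -/
lemma two_div_mem_leftBoundary {s : ℕ} (hs : 4 ≤ s) : 2 / ((s : ℝ) - 1) ∈ leftBoundary s := by
  have hs1 : (4 : ℝ) ≤ s := by exact_mod_cast hs
  refine ⟨by simpa using const_mem_cantorvalSet hs (two_mem_cantorvalDigits hs), ?_⟩
  convert! const_mem_cantorvalSet hs (succ_mem_cantorvalDigits hs) using 1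
  have : (s : ℝ) - 1 ≠ 0 := by linarith
  push_cast; field_simp; ring

/-- The three contractions generating `leftBoundary s`. -/
noncomputable def leftBoundaryMap (s : ℕ) (i : Fin 3) (x : ℝ) : ℝ :=
  ![x, digitInversion s x, 2 + x] i / s

lemma leftBoundary_eq_iUnion {s : ℕ} (hs : 4 ≤ s) :
    leftBoundary s = ⋃ i, leftBoundaryMap s i '' leftBoundary s := by
  have hs0 : (s : ℝ) ≠ 0 := by positivity
  ext x
  rw [mem_leftBoundary_iff hs]
  simp only [mem_iUnion, mem_image, leftBoundaryMap, Fin.exists_fin_succ, Matrix.cons_val_zero,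
    Matrix.cons_val_succ, IsEmpty.exists_iff, or_false]
  constructor
  · rintro (h | h | h)
    · exact Or.inl ⟨_, h, by field_simp⟩
    · exact Or.inr (Or.inr ⟨_, h, by field_simp; ring⟩)
    · exact Or.inr (Or.inl ⟨_, h, by rw [digitInversion_digitInversion]; field_simp⟩)
  · rintro (⟨y, h, rfl⟩ | ⟨y, h, rfl⟩ | ⟨y, h, rfl⟩)
    · left; rwa [mul_div_cancel₀ _ hs0]
    · right; right; rwa [mul_div_cancel₀ _ hs0, digitInversion_digitInversion]
    · right; left; rwa [mul_div_cancel₀ _ hs0, add_sub_cancel_left]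

lemma dist_digitInversion (s : ℕ) (x y : ℝ) :
    dist (digitInversion s x) (digitInversion s y) = dist x y := by
  rw [digitInversion, digitInversion, dist_sub_left]

lemma dimH_leftBoundary {s : ℕ} (hs : 4 ≤ s) :
    dimH (leftBoundary s) = ENNReal.ofReal (Real.logb s 3) := by
  have hs1 : (4 : ℝ) ≤ s := by exact_mod_cast hs
  have hs0 : (0 : ℝ) < s := by linarith
  have h := dimH_eq_of_selfSimilar (N := 3) (b := s) (f := leftBoundaryMap s) (by norm_num)
    (by linarith) (fun i x y => ?_) (isCompact_leftBoundary hs) ⟨_, two_div_mem_leftBoundary hs⟩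
    (leftBoundary_eq_iUnion hs) (δ := 1 / (3 * s)) (by positivity) ?_
  · exact_mod_cast h
  · have h1 : ∀ u v : ℝ, dist (u / s) (v / s) = (s : ℝ)⁻¹ * dist u v := fun u v => by
      rw [Real.dist_eq, Real.dist_eq, ← sub_div, abs_div, abs_of_pos hs0, div_eq_inv_mul]
    rw [leftBoundaryMap, leftBoundaryMap, h1]
    congr 1
    fin_cases i
    · rfl
    · exact dist_digitInversion s x y
    · exact dist_add_left 2 x y
  · have h1 := two_div_le hs
    have h2 := digitInversion_two_div hs
    have h3 := leftBoundary_subset_Icc hs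
    have h4 := cantorvalSet_bound hs
    -- Before division by `s`, the three pieces lie in `[0, 2/3]`, `[1, 5/3]` and `[2, ∞)`, ordered
    -- as their indices. The gaps of `1/3` explain `δ = 1/(3s)`.
    have hlt : ∀ i j, i < j → ∀ x ∈ leftBoundary s, ∀ y ∈ leftBoundary s,
        1 / (3 * (s : ℝ)) ≤ leftBoundaryMap s j y - leftBoundaryMap s i x := by
      intro i j hij x hx y hy
      have hx' := h3 hx
      have hy' := h3 hy
      rw [leftBoundaryMap, leftBoundaryMap, ← sub_div, ← div_div]
      refine div_le_div_of_nonneg_right ?_ hs0.le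
      simp only [digitInversion] at h2 ⊢
      obtain ⟨_, hx2⟩ := hx'
      obtain ⟨_, hy2⟩ := hy'
      fin_cases i <;> fin_cases j <;> simp at hij ⊢ <;> linarith
    intro i j hij x hx y hy
    rw [Real.dist_eq]
    rcases lt_or_gt_of_ne hij with h | h
    · exact (hlt i j h x hx y hy).trans (by rw [abs_sub_comm]; exact le_abs_self _)
    · exact (hlt j i h y hy x hx).trans (le_abs_self _)

/-- Interior would force dimension `1`, that is `s = 3`. -/
lemma interior_leftBoundary {s : ℕ} (hs : 4 ≤ s) : interior (leftBoundary s) = ∅ := by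
  by_contra h
  have h1 := Real.dimH_of_nonempty_interior (nonempty_iff_ne_empty.2 h)
  have hs1 : (4 : ℝ) ≤ s := by exact_mod_cast hs
  rw [dimH_leftBoundary hs, Module.finrank_self, Nat.cast_one, ENNReal.ofReal_eq_one,
    Real.logb_eq_iff_rpow_eq (by linarith) (by linarith) (by norm_num), Real.rpow_one] at h1
  linarith

/-! ### The boundary as the union of the two overlaps -/

/-- The boundary of `E_s` is the disjoint union of `leftBoundary s` and of its mirror image. -/
lemma mem_frontier_cantorvalSet_iff {s : ℕ} (hs : 4 ≤ s) {x : ℝ} :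
    x ∈ frontier (cantorvalSet s) ↔ x ∈ leftBoundary s ∨ digitInversion s x ∈ leftBoundary s := by
  have hcl := (isCompact_cantorvalSet hs).isClosed
  constructor
  · intro hx
    have hxE := hcl.frontier_subset hx
    have hx' : x ∈ closure (cantorvalSet s)ᶜ := by
      rw [closure_compl]; exact hx.2
    have hI := cantorvalSet_subset_Icc hs hxE
    have hbd := cantorvalSet_bound hs
    -- In this window only the translates by `-1`, `0`, `1` can reach a point, because `E_s ⊆ [0,
    -- 5/3]`.
    have hU : Ioo (-1 / 3 : ℝ) 2 ∈ 𝓝 x :=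
      Ioo_mem_nhds (by linarith [hI.1]) (by linarith [hI.2])
    let T : Set ℝ := (fun y => y + 1) ⁻¹' cantorvalSet s ∪ (fun y => y - 1) ⁻¹' cantorvalSet s
    have hT : IsClosed T := (hcl.preimage (continuous_add_const 1)).union
      (hcl.preimage (continuous_sub_right 1))
    have hsub : Ioo (-1 / 3 : ℝ) 2 ∩ (cantorvalSet s)ᶜ ⊆ T := by
      rintro y ⟨⟨hy1, hy2⟩, hyE⟩
      obtain ⟨k, hk⟩ := exists_int_sub_mem_cantorvalSet hs y
      have hkI := cantorvalSet_subset_Icc hs hk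
      have hk1 : k < 2 := by
        have : (k : ℝ) < (2 : ℤ) := by push_cast; linarith [hkI.1]
        exact_mod_cast this
      have hk2 : -2 < k := by
        have : ((-2 : ℤ) : ℝ) < k := by push_cast; linarith [hkI.2]
        exact_mod_cast this
      obtain rfl | rfl | rfl : k = -1 ∨ k = 0 ∨ k = 1 := by omega
      · left; simpa using hk
      · exact absurd (by simpa using hk) hyE
      · right; simpa using hk
    have hxT : x ∈ T := hT.closure_subset_iff.2 hsub
      ((mem_closure_iff_nhdsWithin_neBot.1 hx' |> fun h => by
        rw [mem_closure_iff_nhdsWithin_neBot, inter_comm, nhdsWithin_inter_of_mem' ?_]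
        · exact h
        · exact mem_nhdsWithin_of_mem_nhds hU))
    rcases hxT with h | h
    · exact Or.inl ⟨hxE, h⟩
    · exact Or.inr ((digitInversion_mem_leftBoundary_iff hs).2 ⟨hxE, h⟩)
  -- If `y` were interior, interior points of `E_s` close to `y + c`, moved back by `c`, would be
  -- interior to `E_s ∩ (E_s - c)`.
  · have hmain : ∀ (c : ℝ) (y : ℝ), y ∈ cantorvalSet s → y + c ∈ cantorvalSet s →
        interior {z | z ∈ cantorvalSet s ∧ z + c ∈ cantorvalSet s} = ∅ →
        y ∈ frontier (cantorvalSet s) := by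
      intro c y hy hyc hint
      rw [hcl.frontier_eq]
      refine ⟨hy, fun hyi => ?_⟩
      have h1 := cantorvalSet_subset_closure_interior hs hyc
      have h2 : (fun z => z - c) ⁻¹' interior (cantorvalSet s) ∈ 𝓝 (y + c) :=
        (continuous_sub_right c).continuousAt.preimage_mem_nhds
          (by simpa using isOpen_interior.mem_nhds hyi)
      obtain ⟨z, hz1, hz2⟩ := mem_closure_iff_nhds.1 h1 _ h2
      have h3 : z - c ∈ interior {z | z ∈ cantorvalSet s ∧ z + c ∈ cantorvalSet s} := by
        refine mem_interior.2 ⟨interior (cantorvalSet s) ∩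
          (fun z => z + c) ⁻¹' interior (cantorvalSet s), ?_, ?_, hz1, by simpa using hz2⟩
        · exact fun w hw => ⟨interior_subset hw.1, interior_subset hw.2⟩
        · exact isOpen_interior.inter (isOpen_interior.preimage (continuous_add_const c))
      rw [hint] at h3
      exact h3
    rintro (⟨h1, h2⟩ | h)
    · exact hmain 1 x h1 h2 (interior_leftBoundary hs)
    · have h' := (digitInversion_mem_leftBoundary_iff hs).1 h
      refine hmain (-1) x h'.1 (by simpa [sub_eq_add_neg] using h'.2) ?_
      have hset : {z | z ∈ cantorvalSet s ∧ z + -1 ∈ cantorvalSet s} =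
          (Homeomorph.subLeft (((s : ℝ) + 1) / ((s : ℝ) - 1))) ⁻¹' leftBoundary s := by
        ext z
        exact (digitInversion_mem_leftBoundary_iff hs).symm
      rw [hset, ← Homeomorph.preimage_interior, interior_leftBoundary hs, preimage_empty]

/-! ### Decomposition of the boundary into similar copies -/

lemma involutive_digitInversion (s : ℕ) : Function.Involutive (digitInversion s) :=
  digitInversion_digitInversion s

lemma prefixMap_zero (s : ℕ) (x : ℝ) : prefixMap s 0 x = x / s := by simp [prefixMap]

lemma prefixMap_succ {s : ℕ} (hs : 4 ≤ s) (i : ℕ) (x : ℝ) :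
    prefixMap s (i + 1) x = (2 + prefixMap s i x) / s := by
  have hs0 : (s : ℝ) ≠ 0 := by positivity
  rw [prefixMap, prefixMap, Finset.sum_range_succ', add_div, add_div, Finset.sum_div, div_div,
    ← pow_succ]
  simp only [div_div, ← pow_succ]
  ring

lemma dist_prefixMap (s i : ℕ) (x y : ℝ) :
    dist (prefixMap s i x) (prefixMap s i y) = ((s : ℝ) ^ (i + 1))⁻¹ * dist x y := by
  rw [prefixMap, prefixMap, dist_add_left, Real.dist_eq, Real.dist_eq, ← sub_div, abs_div,
    abs_of_nonneg (by positivity : (0 : ℝ) ≤ (s : ℝ) ^ (i + 1)), div_eq_inv_mul]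

lemma dist_boundarySimilarity (s i : ℕ) (b : Bool) (x y : ℝ) :
    dist (boundarySimilarity s (i, b) x) (boundarySimilarity s (i, b) y)
      = ((s : ℝ) ^ (i + 1))⁻¹ * dist x y := by
  cases b
  · exact dist_prefixMap s i x y
  · exact (dist_digitInversion s _ _).trans (dist_prefixMap s i x y)

/-- The two branches with leading digit `0` merge into one copy of the whole boundary, leaving a
single recursive branch, with digit `2`. -/
lemma mem_leftBoundary_iff_frontier {s : ℕ} (hs : 4 ≤ s) {x : ℝ} :
    x ∈ leftBoundary s ↔ s * x ∈ frontier (cantorvalSet s) ∨ s * x - 2 ∈ leftBoundary s := by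
  rw [mem_leftBoundary_iff hs, mem_frontier_cantorvalSet_iff hs]
  tauto

lemma frontier_cantorvalSet_subset_Icc {s : ℕ} (hs : 4 ≤ s) :
    frontier (cantorvalSet s) ⊆ Icc 0 (5 / 3) := fun _ hx =>
  Icc_subset_Icc_right (cantorvalSet_bound hs) (cantorvalSet_subset_Icc hs
    ((isCompact_cantorvalSet hs).isClosed.frontier_subset hx))

lemma prefixMap_mem_leftBoundary {s : ℕ} (hs : 4 ≤ s) {x : ℝ}
    (hx : x ∈ frontier (cantorvalSet s)) (i : ℕ) : prefixMap s i x ∈ leftBoundary s := by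
  have hs0 : (s : ℝ) ≠ 0 := by positivity
  rw [mem_leftBoundary_iff_frontier hs]
  induction i with
  | zero => left; rwa [prefixMap_zero, mul_div_cancel₀ _ hs0]
  | succ i ih =>
    right
    rw [prefixMap_succ hs, mul_div_cancel₀ _ hs0, add_sub_cancel_left]
    exact (mem_leftBoundary_iff_frontier hs).2 ih

/-- `leftBoundary s` consists of copies of the boundary and of the fixed point of the digit `2`. -/
lemma leftBoundary_eq_iUnion_prefixMap {s : ℕ} (hs : 4 ≤ s) :
    leftBoundary s =
      (⋃ i, prefixMap s i '' frontier (cantorvalSet s)) ∪ {2 / ((s : ℝ) - 1)} := by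
  have hs1 : (4 : ℝ) ≤ s := by exact_mod_cast hs
  have hs0 : (0 : ℝ) < s := by linarith
  have hfix : (s : ℝ) * (2 / ((s : ℝ) - 1)) - 2 = 2 / ((s : ℝ) - 1) := by
    have : (s : ℝ) - 1 ≠ 0 := by linarith
    field_simp; ring
  -- Either the recursion ends in a copy of the boundary, or the digit-2 branch is taken `n` times,
  -- which brings `x` within `s⁻ⁿ` of its fixed point.
  have happrox : ∀ n : ℕ, ∀ x ∈ leftBoundary s,
      (∃ i, x ∈ prefixMap s i '' frontier (cantorvalSet s)) ∨
        |x - 2 / ((s : ℝ) - 1)| ≤ (s : ℝ)⁻¹ ^ n := by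
    intro n
    induction n with
    | zero =>
      intro x hx
      right
      have h1 := leftBoundary_subset_Icc hs hx
      have h2 := two_div_le hs
      rw [pow_zero, abs_le]
      constructor <;> linarith [h1.1, h1.2]
    | succ n ih =>
      intro x hx
      rcases (mem_leftBoundary_iff_frontier hs).1 hx with h | h
      · exact Or.inl ⟨0, _, h, by rw [prefixMap_zero, mul_div_cancel_left₀ _ hs0.ne']⟩
      · rcases ih _ h with ⟨i, y, hy, hyx⟩ | h
        · exact Or.inl ⟨i + 1, y, hy, by rw [prefixMap_succ hs, hyx]; field_simp; ring⟩
        · right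
          have h3 : (s : ℝ) * x - 2 - 2 / ((s : ℝ) - 1) = s * (x - 2 / ((s : ℝ) - 1)) := by
            linear_combination hfix
          rw [h3, abs_mul, abs_of_pos hs0] at h
          rw [pow_succ, ← div_eq_mul_inv, le_div_iff₀ hs0, mul_comm]
          exact h
  ext x
  constructor
  · intro hx
    by_cases h : ∃ i, x ∈ prefixMap s i '' frontier (cantorvalSet s)
    · exact Or.inl (mem_iUnion.2 h)
    · right
      have hlim := ge_of_tendsto' (tendsto_pow_atTop_nhds_zero_of_lt_one (by positivity)
        (inv_lt_one_of_one_lt₀ (by linarith : (1 : ℝ) < s)))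
        fun n => (happrox n x hx).resolve_left h
      exact sub_eq_zero.1 (abs_nonpos_iff.1 hlim)
  · rintro (h | rfl)
    · obtain ⟨i, y, hy, rfl⟩ := mem_iUnion.1 h
      exact prefixMap_mem_leftBoundary hs hy i
    · exact two_div_mem_leftBoundary hs

/-- The first digit separates: `s * φ_0 ≤ 5/3 < 2 ≤ s * φ_{k+1}` on the boundary. Common leading
digits `2` cancel. -/
lemma prefixMap_index_unique {s : ℕ} (hs : 4 ≤ s) {x y : ℝ} (hx : x ∈ frontier (cantorvalSet s))
    (hy : y ∈ frontier (cantorvalSet s)) {i j : ℕ} (h : prefixMap s i x = prefixMap s j y) :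
    i = j := by
  have hs0 : (s : ℝ) ≠ 0 := by positivity
  have hzero : ∀ z ∈ frontier (cantorvalSet s), ∀ w ∈ frontier (cantorvalSet s), ∀ k,
      prefixMap s 0 z ≠ prefixMap s (k + 1) w := by
    intro z hz w hw k h
    rw [prefixMap_zero, prefixMap_succ hs, div_left_inj' hs0] at h
    have h1 := (frontier_cantorvalSet_subset_Icc hs hz).2
    have h2 := (leftBoundary_subset_Icc hs (prefixMap_mem_leftBoundary hs hw k)).1
    linarith
  induction i generalizing j with
  | zero =>
    cases j with
    | zero => rfl
    | succ j => exact absurd h (hzero x hx y hy j)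
  | succ i ih =>
    cases j with
    | zero => exact absurd h.symm (hzero y hy x hx i)
    | succ j =>
      rw [prefixMap_succ hs, prefixMap_succ hs, div_left_inj' hs0, add_right_inj] at h
      rw [ih h]

/-- Cancelling leading digits `2` fixes `2/(s - 1)`, so equality reduces to `i = 0`, where `x = 2 +
2/(s - 1)` exceeds `5/3`. -/
lemma prefixMap_ne_two_div {s : ℕ} (hs : 4 ≤ s) {x : ℝ} (hx : x ∈ frontier (cantorvalSet s))
    (i : ℕ) : prefixMap s i x ≠ 2 / ((s : ℝ) - 1) := by
  have hs1 : (4 : ℝ) ≤ s := by exact_mod_cast hs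
  have hs0 : (0 : ℝ) < s := by linarith
  have hfix : 2 / ((s : ℝ) - 1) * s = 2 / ((s : ℝ) - 1) + 2 := by
    have : (s : ℝ) - 1 ≠ 0 := by linarith
    field_simp; ring
  have hpos : 0 < 2 / ((s : ℝ) - 1) := div_pos two_pos (by linarith)
  induction i with
  | zero =>
    intro h
    rw [prefixMap_zero, div_eq_iff hs0.ne', hfix] at h
    have h1 := (frontier_cantorvalSet_subset_Icc hs hx).2
    linarith
  | succ i ih =>
    intro h
    rw [prefixMap_succ hs, div_eq_iff hs0.ne', hfix] at h
    exact ih (by linarith)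

/-- The left part of the boundary does not meet its mirror image. -/
lemma digitInversion_notMem_leftBoundary {s : ℕ} (hs : 4 ≤ s) {x : ℝ} (hx : x ∈ leftBoundary s) :
    digitInversion s x ∉ leftBoundary s := by
  intro h
  have h1 := (leftBoundary_subset_Icc hs hx).2
  have h2 := (leftBoundary_subset_Icc hs h).2
  have h3 := two_div_le hs
  have h4 := digitInversion_two_div hs
  simp only [digitInversion] at h2 h4
  linarith

lemma image_boundarySimilarity_false (s i : ℕ) (A : Set ℝ) :
    boundarySimilarity s (i, false) '' A = prefixMap s i '' A := rfl

lemma image_boundarySimilarity_true (s i : ℕ) (A : Set ℝ) :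
    boundarySimilarity s (i, true) '' A = digitInversion s ⁻¹' (prefixMap s i '' A) := by
  ext x
  constructor
  · rintro ⟨y, hy, rfl⟩
    exact ⟨y, hy, (digitInversion_digitInversion s _).symm⟩
  · rintro ⟨y, hy, h⟩
    exact ⟨y, hy, (congrArg (digitInversion s) h).trans (digitInversion_digitInversion s x)⟩

lemma frontier_cantorvalSet_eq {s : ℕ} (hs : 4 ≤ s) :
    frontier (cantorvalSet s) =
      (⋃ p : ℕ × Bool, boundarySimilarity s p '' frontier (cantorvalSet s)) ∪
        {2 / ((s : ℝ) - 1), 1} := by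
  have hone : ∀ x, digitInversion s x = 2 / ((s : ℝ) - 1) ↔ x = 1 := fun x => by
    have h := digitInversion_two_div hs
    simp only [digitInversion] at h ⊢
    constructor <;> intro h' <;> linarith
  ext x
  rw [mem_frontier_cantorvalSet_iff hs, leftBoundary_eq_iUnion_prefixMap hs]
  simp only [mem_union, mem_iUnion, mem_singleton_iff, mem_insert_iff, hone, Prod.exists,
    Bool.exists_bool, image_boundarySimilarity_false, image_boundarySimilarity_true, mem_preimage,
    exists_or]
  tauto

lemma disjoint_image_boundarySimilarity {s : ℕ} (hs : 4 ≤ s) {p q : ℕ × Bool} (hpq : p ≠ q) :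
    Disjoint (boundarySimilarity s p '' frontier (cantorvalSet s))
      (boundarySimilarity s q '' frontier (cantorvalSet s)) := by
  have hinj := (involutive_digitInversion s).injective
  rw [Set.disjoint_left]
  rintro _ ⟨x, hx, rfl⟩ ⟨y, hy, h⟩
  apply hpq
  obtain ⟨i, b⟩ := p
  obtain ⟨j, c⟩ := q
  have hxB := prefixMap_mem_leftBoundary hs hx i
  have hyB := prefixMap_mem_leftBoundary hs hy j
  cases b <;> cases c <;>
    simp only [boundarySimilarity, if_true, if_false, Bool.false_eq_true] at h
  · rw [prefixMap_index_unique hs hy hx h]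
  · exact absurd (h ▸ hxB) (digitInversion_notMem_leftBoundary hs hyB)
  · exact absurd (h ▸ hyB) (digitInversion_notMem_leftBoundary hs hxB)
  · rw [prefixMap_index_unique hs hy hx (hinj h)]

lemma disjoint_image_boundarySimilarity_pair {s : ℕ} (hs : 4 ≤ s) (p : ℕ × Bool) :
    Disjoint (boundarySimilarity s p '' frontier (cantorvalSet s)) {2 / ((s : ℝ) - 1), 1} := by
  have hinj := (involutive_digitInversion s).injective
  have h1 := digitInversion_two_div hs
  have h2 := two_div_mem_leftBoundary hs
  rw [Set.disjoint_left]
  rintro _ ⟨x, hx, rfl⟩ h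
  obtain ⟨i, b⟩ := p
  have hxB := prefixMap_mem_leftBoundary hs hx i
  have hne := prefixMap_ne_two_div hs hx i
  cases b <;> simp only [boundarySimilarity, if_true, if_false, Bool.false_eq_true,
    mem_insert_iff, mem_singleton_iff] at h <;> rcases h with h | h
  · exact hne h
  · exact digitInversion_notMem_leftBoundary hs h2 (by rwa [h1, ← h])
  · exact digitInversion_notMem_leftBoundary hs hxB (by rwa [h])
  · exact hne (hinj (h.trans h1.symm))

/-! ### Dimension of the boundary, the Moran equation and the case `s = 4` -/

lemma dimH_frontier_cantorvalSet {s : ℕ} (hs : 4 ≤ s) :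
    dimH (frontier (cantorvalSet s)) = ENNReal.ofReal (Real.logb s 3) := by
  have h : frontier (cantorvalSet s) =
      leftBoundary s ∪ (digitInversion s) '' leftBoundary s := by
    ext x
    rw [mem_frontier_cantorvalSet_iff hs,
      image_eq_preimage_of_inverse (involutive_digitInversion s) (involutive_digitInversion s)]
    rfl
  have hiso : Isometry (digitInversion s) := Isometry.of_dist_eq (dist_digitInversion s)
  rw [h, dimH_union, hiso.dimH_image, max_self, dimH_leftBoundary hs]

/-- The Moran equation of countably many ratios `b⁻ⁱ`, each occurring twice. -/
lemma hasSum_two_mul_rpow_iff {b : ℝ} (hb : 1 < b) (x : ℝ) :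
    HasSum (fun i : ℕ => 2 * b ^ (-(((i : ℝ) + 1) * x))) 1 ↔ x = Real.logb b 3 := by
  have hb0 : 0 < b := by linarith
  have hq : 0 < b ^ (-x) := Real.rpow_pos_of_pos hb0 _
  -- With `q = b ^ (-x)` the series is geometric; summability forces `q < 1`, and `2q/(1 - q) = 1`
  -- means `q = 1/3`.
  have hterm : (fun i : ℕ => 2 * b ^ (-(((i : ℝ) + 1) * x))) =
      fun i : ℕ => 2 * b ^ (-x) * (b ^ (-x)) ^ i := by
    ext i
    rw [mul_assoc, ← pow_succ', ← Real.rpow_mul_natCast hb0.le]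
    push_cast
    ring_nf
  have hlog : x = Real.logb b 3 ↔ b ^ (-x) = 1 / 3 := by
    rw [eq_comm, Real.logb_eq_iff_rpow_eq hb0 hb.ne' (by norm_num), Real.rpow_neg hb0.le,
      one_div, inv_inj]
  rw [hterm, hlog]
  constructor
  · intro h
    have hlt : b ^ (-x) < 1 := by
      have h' := (summable_mul_left_iff (by positivity)).1 h.summable
      rw [summable_geometric_iff_norm_lt_one, Real.norm_of_nonneg hq.le] at h'
      exact h'
    have h2 := h.unique ((hasSum_geometric_of_lt_one hq.le hlt).mul_left _)
    rw [← div_eq_mul_inv, eq_div_iff (by linarith)] at h2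
    linarith
  · intro h
    rw [h]
    convert! (hasSum_geometric_of_lt_one (r := (1 / 3 : ℝ)) (by norm_num) (by norm_num)).mul_left
      (2 * (1 / 3) : ℝ) using 1
    norm_num

lemma cantorvalSet_four : cantorvalSet 4 = guthrieNymannSet := by
  have hd : cantorvalDigits 4 = {0, 2, 3, 5} := by
    ext d
    change (d ≤ 5 ∧ d ≠ 1 ∧ d ≠ 4) ↔ (d = 0 ∨ d = 2 ∨ d = 3 ∨ d = 5)
    omega
  simp only [cantorvalSet, guthrieNymannSet, hd, Nat.cast_ofNat]

theorem mainTheorem9 :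
    (∀ s : ℕ, 4 ≤ s →
      -- each of the maps is a similarity; the ratio `s^{-(i+1)}` occurs twice for every `i`
      (∀ (i : ℕ) (b : Bool) (x y : ℝ),
        dist (boundarySimilarity s (i, b) x) (boundarySimilarity s (i, b) y)
          = ((s : ℝ) ^ (i + 1))⁻¹ * dist x y) ∧
      -- the boundary is the union of its similar copies and of two further points
      frontier (cantorvalSet s) =
        (⋃ p : ℕ × Bool, boundarySimilarity s p '' frontier (cantorvalSet s)) ∪
          {2 / ((s : ℝ) - 1), 1} ∧
      -- the copies are pairwise disjoint
      (∀ p q : ℕ × Bool, p ≠ q →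
        Disjoint (boundarySimilarity s p '' frontier (cantorvalSet s))
          (boundarySimilarity s q '' frontier (cantorvalSet s))) ∧
      -- the two further points lie in none of the copies
      (∀ p : ℕ × Bool,
        Disjoint (boundarySimilarity s p '' frontier (cantorvalSet s))
          {2 / ((s : ℝ) - 1), 1}) ∧
      -- the Hausdorff dimension, and the equation whose only real root it is
      dimH (frontier (cantorvalSet s)) = ENNReal.ofReal (Real.logb s 3) ∧
      (∀ x : ℝ,
        HasSum (fun i : ℕ => 2 * (s : ℝ) ^ (-(((i : ℝ) + 1) * x))) 1 ↔
          x = Real.logb s 3)) ∧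
    -- the case of the Guthrie–Nymann Cantorval
    cantorvalSet 4 = guthrieNymannSet ∧
    dimH (frontier guthrieNymannSet) = ENNReal.ofReal (Real.logb 4 3) := by
  refine ⟨fun s hs => ⟨dist_boundarySimilarity s, frontier_cantorvalSet_eq hs,
    fun p q => disjoint_image_boundarySimilarity hs, disjoint_image_boundarySimilarity_pair hs,
    dimH_frontier_cantorvalSet hs, hasSum_two_mul_rpow_iff (by exact_mod_cast (by omega : 1 < s))⟩,
    cantorvalSet_four, ?_⟩
  rw [← cantorvalSet_four]
  exact_mod_cast dimH_frontier_cantorvalSet le_rfl
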